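/- **Conventions.** A *finite groupoid* is a groupoid with finitely many isomorphism classes and finite hom-sets; its homotopy cardinality is $\|S\|=\sum_{s\in\pi_0S}1/|\mathrm{Aut}(s)|$. Let $\mathbf P=B\{\pm1\}$ be the one-object groupoid of the group $\{\pm1\}$. A *parity structure* on a finite groupoid $T$ is a functor $\mathrm{par}\colon T\to\mathbf P$; arrows sent to $-1$ are called odd. A point of $T$ is *orientable* if it has no odd automorphisms, and $T^\circ\subseteq T$ is the full subgroupoid of orientable points. A *$\mathbf P$-span* $M\colon I\to J$ is a span of finite groupoids $I\xleftarrow{p}M\xrightarrow{q}J$ with a natural transformation $\rho\colon \mathrm{par}\circ p\Rightarrow\mathrm{par}\circ q$. An equivalence of $\mathbf P$-spans $(M,\rho)\simeq(M',\rho')$ is an equivalence $u\colon M\to M'$ with natural isomorphisms $\sigma\colon p\cong p'u$, $\tau\colon q\cong q'u$ such that $\mathrm{par}(\sigma_x)\rho'_{ux}=\rho_x\,\mathrm{par}(\tau_x)$ for all $x$. Spans compose by homotopy pullback: the points of $M\times_JN$ are triples $(m,n,a)$ with $a\colon q(m)\to p(n)$ in $J$, and its $2$-cell has component $\rho_m\cdot\mathrm{par}(a)\cdot\rho'_n$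 there. The category $\mathbf{lin}^{\pm}$ has as objects the finite groupoids with parity structure $T$ (standing for the slices $\mathcal Z_{/T}$), and as morphisms the $\mathbf P$-spans up to equivalence. A *scalar* is a $\mathbf P$-span $S$ from the terminal groupoid $1$ to itself. Its $2$-cell splits $S$ as $S_\oplus\sqcup S_\ominus$ according to the value $\pm1$, and $\|S\|:=\|S_\oplus\|-\|S_\ominus\|$. For points $i\in I$, $j\in J$, the two-sided homotopy fibre ${}_iM_j$ is the scalar whose points are $(m,\ a\colon i\to p(m),\ b\colon q(m)\to j)$, with sign $\mathrm{par}(a)\,\rho_m\,\mathrm{par}(b)$. The group $j!=\mathrm{Aut}(j)$ acts on it by $b\mapsto b\cdot g$. If $j$ is orientable this action preserves signs, and ${}_iM_j/j!$ denotes the weak quotient scalar. **Proposition.** For every $T$ choose a representative point in each component of $T^\circ$. Put $\|\mathcal Z_{/T}\|:=\mathbb Q_{\pi_0(T^\circ)}$, the vector space with basis $\pi_0(T^\circ)$. For a $\mathbf P$-span $M\colon I\to J$, let $[M]$ be the $\pi_0(I^\circ)\times\pi_0(J^\circ)$-matrix with entries $${}_i[M]_j:=\|{}_iM_j/j!\|$$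 computed at the chosen representatives, and let $\|M\|\colon\mathbb Q_{\pi_0(I^\circ)}\to\mathbb Q_{\pi_0(J^\circ)}$ be the linear map $e_i\mapsto\sum_j{}_i[M]_j\,e_j$. Then $\|M\|$ depends only on the equivalence class of $M$, and these assignments define a functor $\mathbf{lin}^{\pm}\to\mathbf{vect}_{\mathbb Q}$ to finite-dimensional rational vector spaces. In particular, for $\mathbf P$-spans $M\colon I\to J$ and $N\colon J\to K$, and all $i\in\pi_0(I^\circ)$, $k\in\pi_0(K^\circ)$, $${}_i[M\times_JN]_k=\sum_{j\in\pi_0(J^\circ)}{}_i[M]_j\cdot{}_j[N]_k .$$ The non-orientable points of $J$ contribute zero: if $j\in J$ is not orientable, then $\|{}_iM_j\|=0$ for every point $i\in I$ and $\|{}_jN_k\|=0$ for every point $k\in K$. -/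

import Mathlib

open CategoryTheory

universe u

/-! ## Finite groupoids and homotopy cardinality -/

/-- The set `π₀ C` of isomorphism classes of objects of `C`; for a groupoid these are the
connected components. -/
def Pi0 (C : Type*) [Category C] : Type _ := Quotient (isIsomorphicSetoid C)

/-- The class of an object in `π₀`. -/
def Pi0.mk {C : Type*} [Category C] (x : C) : Pi0 C := Quotient.mk (isIsomorphicSetoid C) x

theorem Pi0.sound {C : Type*} [Category C] {x y : C} (e : x ≅ y) : Pi0.mk x = Pi0.mk y :=
  Quotient.sound (s := isIsomorphicSetoid C) ⟨e⟩

theorem Pi0.exact {C : Type*} [Category C] {x y : C} (h : Pi0.mk x = Pi0.mk y) :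
    Nonempty (x ≅ y) :=
  Quotient.exact (s := isIsomorphicSetoid C) h

/-- A chosen object in an isomorphism class. -/
noncomputable def Pi0.out {C : Type*} [Category C] (c : Pi0 C) : C :=
  Quotient.out (s := isIsomorphicSetoid C) c

theorem Pi0.mk_out {C : Type*} [Category C] (c : Pi0 C) : Pi0.mk c.out = c :=
  Quotient.out_eq (s := isIsomorphicSetoid C) c

/-- Homotopy finiteness: finitely many isomorphism classes and finite hom sets. A groupoid with
this property is what is called a finite groupoid below. -/
class HFinite (C : Type*) [Category C] : Prop where
  finite_pi0 : Finite (Pi0 C)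
  finite_hom : ∀ x y : C, Finite (x ⟶ y)

attribute [instance] HFinite.finite_pi0 HFinite.finite_hom

noncomputable instance (C : Type*) [Category C] [HFinite C] : Fintype (Pi0 C) :=
  Fintype.ofFinite _

/-- Homotopy cardinality of a finite groupoid: the sum over `π₀` of `1 / |Aut|`. -/
noncomputable def homotopyCard (C : Type*) [Category C] [HFinite C] : ℚ :=
  ∑ c : Pi0 C, 1 / (Nat.card (Aut c.out) : ℚ)

instance (C : Type*) [Category C] [HFinite C] (P : ObjectProperty C) :
    HFinite P.FullSubcategory where
  finite_pi0 := by
    let φ : Pi0 P.FullSubcategory → Pi0 C :=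
      Quotient.map' (s₁ := isIsomorphicSetoid _) (s₂ := isIsomorphicSetoid C) (fun x => x.obj)
        (fun x y ⟨e⟩ => ⟨P.ι.mapIso e⟩)
    refine Finite.of_injective φ ?_
    rintro ⟨x⟩ ⟨y⟩ h
    obtain ⟨e⟩ := Pi0.exact (C := C) h
    exact Pi0.sound (P.isoMk e)
  finite_hom x y := Finite.of_injective (fun f : x ⟶ y => f.hom) fun f g h => by
    ext; exact h

section Comma

variable {A B T : Type*} [Category A] [Category B] [Category T] (L : A ⥤ T) (R : B ⥤ T)

instance [IsGroupoid A] [IsGroupoid B] : IsGroupoid (Comma L R) where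
  all_isIso {X Y} f :=
    (Comma.isoMk (asIso f.left) (asIso f.right) f.w : X ≅ Y).isIso_hom

instance [IsGroupoid A] [IsGroupoid B] [HFinite A] [HFinite B] [HFinite T] :
    HFinite (Comma L R) where
  finite_pi0 := by
    refine Finite.of_surjective (α := Σ c : Pi0 A × Pi0 B, (L.obj c.1.out ⟶ R.obj c.2.out))
      (fun c => Pi0.mk (⟨_, _, c.2⟩ : Comma L R)) ?_
    rintro ⟨X⟩
    obtain ⟨e⟩ := Pi0.exact (Pi0.mk_out (Pi0.mk X.left))
    obtain ⟨e'⟩ := Pi0.exact (Pi0.mk_out (Pi0.mk X.right))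
    refine ⟨⟨(Pi0.mk X.left, Pi0.mk X.right), L.map e.hom ≫ X.hom ≫ R.map e'.inv⟩, ?_⟩
    refine Pi0.sound (Comma.isoMk e e' ?_)
    simp [← R.map_comp]
  finite_hom X Y := Finite.of_injective
    (fun f : X ⟶ Y => ((f.left, f.right) : (X.left ⟶ Y.left) × (X.right ⟶ Y.right)))
    fun f g h => by
      simp only [Prod.mk.injEq] at h
      exact CommaMorphism.ext h.1 h.2

/-- The invertible `2`-cell of the homotopy pullback square. -/
noncomputable def commaIso [IsGroupoid T] : Comma.fst L R ⋙ L ≅ Comma.snd L R ⋙ R :=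
  NatIso.ofComponents (fun X => asIso X.hom) fun f => f.w

theorem isEquivalence_comma_snd [IsGroupoid T] : (Comma.snd (𝟭 T) R).IsEquivalence where
  faithful := ⟨fun {X Y} f g h => by
    have w1 := f.w
    have h' : f.right = g.right := h
    rw [h', ← g.w] at w1
    exact CommaMorphism.ext ((cancel_mono Y.hom).1 w1) h'⟩
  full := ⟨fun {X Y} f => ⟨⟨X.hom ≫ R.map f ≫ inv Y.hom, f, by simp⟩, rfl⟩⟩
  essSurj := ⟨fun m => ⟨⟨R.obj m, m, 𝟙 _⟩, ⟨Iso.refl _⟩⟩⟩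

theorem isEquivalence_comma_fst [IsGroupoid T] : (Comma.fst L (𝟭 T)).IsEquivalence where
  faithful := ⟨fun {X Y} f g h => by
    have w1 := f.w
    have h' : f.left = g.left := h
    rw [h', g.w] at w1
    exact CommaMorphism.ext h' ((cancel_epi X.hom).1 w1).symm⟩
  full := ⟨fun {X Y} f => ⟨⟨f, inv X.hom ≫ L.map f ≫ Y.hom, by simp⟩, rfl⟩⟩
  essSurj := ⟨fun m => ⟨⟨m, L.obj m, 𝟙 _⟩, ⟨Iso.refl _⟩⟩⟩

/-- The comparison of the two iterated homotopy pullbacks. -/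
def commaAssoc {C T' : Type*} [Category C] [Category T'] (R' : B ⥤ T') (K : C ⥤ T') :
    Comma (Comma.snd L R ⋙ R') K ⥤ Comma L (Comma.fst R' K ⋙ R) where
  obj X := ⟨X.left.left, ⟨X.left.right, X.right, X.hom⟩, X.left.hom⟩
  map f := ⟨f.left.left, ⟨f.left.right, f.right, f.w⟩, f.left.w⟩

theorem isEquivalence_commaAssoc {C T' : Type*} [Category C] [Category T'] (R' : B ⥤ T')
    (K : C ⥤ T') : (commaAssoc L R R' K).IsEquivalence where
  faithful := ⟨fun {X Y} f g h => by
    refine CommaMorphism.ext (CommaMorphism.ext ?_ ?_) ?_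
    · exact congrArg (fun k => k.left) h
    · exact congrArg (fun k => k.right.left) h
    · exact congrArg (fun k => k.right.right) h⟩
  full := ⟨fun {X Y} f => ⟨⟨⟨f.left, f.right.left, f.w⟩, f.right.right, f.right.w⟩, rfl⟩⟩
  essSurj := ⟨fun Y =>
    ⟨⟨⟨Y.left, Y.right.left, Y.hom⟩, Y.right.right, Y.right.hom⟩, ⟨Iso.refl _⟩⟩⟩

end Comma

instance : HFinite (Discrete PUnit.{u + 1}) where
  finite_pi0 := Finite.of_surjective Pi0.mk (by rintro ⟨x⟩; exact ⟨x, rfl⟩)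
  finite_hom _ _ := inferInstance

/-! ## Parity structures -/

/-- The one-object groupoid `𝐏 = BO(1)`, where `O(1) = {1, -1}`. -/
abbrev Parities : Type := SingleObj ℤˣ

/-- A finite groupoid with a parity structure, that is, a functor to `𝐏`. -/
structure ParityGroupoid : Type (u + 1) where
  carrier : Type u
  [cat : Category.{u} carrier]
  [isGroupoid : IsGroupoid carrier]
  [finite : HFinite carrier]
  par : carrier ⥤ Parities

namespace ParityGroupoid

instance : CoeSort ParityGroupoid.{u} (Type u) := ⟨carrier⟩

attribute [instance] cat isGroupoid finite

variable {T : ParityGroupoid.{u}}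

/-- The parity of an arrow: `1` for even arrows, `-1` for odd arrows. -/
def parity {x y : T} (a : x ⟶ y) : ℤˣ := T.par.map a

@[simp] theorem parity_id (x : T) : parity (𝟙 x) = 1 := T.par.map_id x

@[simp] theorem parity_comp {x y z : T} (a : x ⟶ y) (b : y ⟶ z) :
    parity (a ≫ b) = parity a * parity b :=
  (T.par.map_comp a b).trans (mul_comm (parity b) (parity a))

theorem parity_iso_inv {x y : T} (e : x ≅ y) : parity e.inv = parity e.hom := by
  have h : parity e.hom * parity e.inv = 1 := by rw [← parity_comp, e.hom_inv_id, parity_id]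
  rw [← Int.units_inv_eq_self (parity e.hom)]
  exact eq_inv_of_mul_eq_one_right h

/-- A point is orientable if it has no odd automorphisms (see `isOrientable_iff` for the
comparison with orientations). -/
def IsOrientable (T : ParityGroupoid.{u}) : ObjectProperty T :=
  fun x => ∀ a : x ⟶ x, parity a = 1

/-- The orientable locus `T°`: the full subgroupoid of the orientable points. -/
abbrev OrientableLocus (T : ParityGroupoid.{u}) : Type u := (IsOrientable T).FullSubcategory

/-- An orientation of a groupoid over `𝐏` is a natural transformation to the constant functor, that
is, a factorisation up to homotopy through the universal cover `𝖾 : 1 → 𝐏`. A point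
is orientable exactly when its connected component admits an orientation. -/
theorem isOrientable_iff (x : T) :
    IsOrientable T x ↔
      Nonempty ((ObjectProperty.ι (fun y : T => Nonempty (y ≅ x)) ⋙ T.par) ⟶
        (Functor.const _).obj (SingleObj.star ℤˣ)) := by
  constructor
  · intro h
    refine ⟨{ app := fun y => parity y.2.some.hom, naturality := ?_ }⟩
    intro y z f
    have key := h (y.2.some.inv ≫ f.hom ≫ z.2.some.hom)
    rw [parity_comp, parity_comp, parity_iso_inv] at key
    change parity z.2.some.hom * parity f.hom = 1 * parity y.2.some.hom
    rw [one_mul, mul_comm]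
    calc parity f.hom * parity z.2.some.hom
        = (parity y.2.some.hom * parity y.2.some.hom) *
            (parity f.hom * parity z.2.some.hom) := by rw [Int.units_mul_self, one_mul]
      _ = _ := by rw [mul_assoc, key, mul_one]
  · rintro ⟨ω⟩ a
    let x' : ObjectProperty.FullSubcategory (fun y : T => Nonempty (y ≅ x)) := ⟨x, ⟨Iso.refl x⟩⟩
    have h := ω.naturality (ObjectProperty.homMk a : x' ⟶ x')
    let w : ℤˣ := ω.app x'
    change w * parity a = 1 * w at h
    rw [one_mul] at h
    exact mul_left_cancel (h.trans (mul_one _).symm)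

/-- The trivial parity structure `𝖾 : 1 → 𝐏`. -/
def unit : ParityGroupoid.{u} where
  carrier := Discrete PUnit.{u + 1}
  par := (Functor.const _).obj (SingleObj.star ℤˣ)

end ParityGroupoid

open ParityGroupoid

/-! ## Spans over `𝐏` -/

/-- A `𝐏`-span `I ← M → J` of finite groupoids, with its `2`-cell down to `𝐏`. -/
structure PSpan (I J : ParityGroupoid.{u}) : Type (u + 1) where
  apex : Type u
  [cat : Category.{u} apex]
  [isGroupoid : IsGroupoid apex]
  [finite : HFinite apex]
  left : apex ⥤ I
  right : apex ⥤ J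
  rho : left ⋙ I.par ⟶ right ⋙ J.par

namespace PSpan

attribute [instance] cat isGroupoid finite

variable {I J K L : ParityGroupoid.{u}}

/-- The component of the `2`-cell at a point of the apex. -/
def sign (M : PSpan I J) (x : M.apex) : ℤˣ := M.rho.app x

theorem sign_naturality (M : PSpan I J) {x y : M.apex} (f : x ⟶ y) :
    parity (M.left.map f) * M.sign y = M.sign x * parity (M.right.map f) := by
  have h := M.rho.naturality f
  change M.sign y * parity (M.left.map f) = parity (M.right.map f) * M.sign x at h
  rw [mul_comm, h, mul_comm]

/-- The identity span, with identity `2`-cell. -/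
abbrev id (I : ParityGroupoid.{u}) : PSpan I I where
  apex := I
  left := 𝟭 _
  right := 𝟭 _
  rho := 𝟙 _

/-- Composition of spans. The apex is the homotopy pullback `M ×_J N`, whose points are triples
`(m, n, a)` with `a : q m ⟶ p n` in `J`, and the `2`-cell is the pasting, with component
`ρ m · par a · ρ' n`. -/
abbrev comp (M : PSpan I J) (N : PSpan J K) : PSpan I K where
  apex := Comma M.right N.left
  left := Comma.fst _ _ ⋙ M.left
  right := Comma.snd _ _ ⋙ N.right
  rho :=
    Functor.whiskerLeft (Comma.fst _ _) M.rho ≫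
      Functor.whiskerRight (Comma.natTrans M.right N.left) J.par ≫
      Functor.whiskerLeft (Comma.snd _ _) N.rho

@[simp] theorem sign_id (x : I) : (PSpan.id I).sign x = 1 := rfl

theorem sign_comp (M : PSpan I J) (N : PSpan J K) (X : Comma M.right N.left) :
    (M.comp N).sign X = M.sign X.left * parity X.hom * N.sign X.right := by
  change N.sign X.right * parity X.hom * M.sign X.left = _
  rw [mul_comm, mul_comm (N.sign X.right), ← mul_assoc]

/-- An equivalence of `𝐏`-spans: an equivalence of the apices, with `2`-cells `σ` and `τ`
compatible with the `2`-cells down to `𝐏`. -/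
structure Equivalence (M N : PSpan I J) where
  u : M.apex ⥤ N.apex
  isEquivalence : u.IsEquivalence
  σ : M.left ≅ u ⋙ N.left
  τ : M.right ≅ u ⋙ N.right
  compat : ∀ x : M.apex,
    parity (σ.hom.app x) * N.sign (u.obj x) = M.sign x * parity (τ.hom.app x)

namespace Equivalence

def refl (M : PSpan I J) : Equivalence M M where
  u := 𝟭 _
  isEquivalence := inferInstance
  σ := Iso.refl _
  τ := Iso.refl _
  compat x := by
    change parity (𝟙 _) * M.sign x = M.sign x * parity (𝟙 _)
    simp

noncomputable def symm {M N : PSpan I J} (e : Equivalence M N) : Equivalence N M :=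
  haveI := e.isEquivalence
  { u := e.u.inv
    isEquivalence := inferInstance
    σ := Functor.isoWhiskerRight e.u.asEquivalence.counitIso.symm N.left ≪≫
      Functor.isoWhiskerLeft e.u.inv e.σ.symm
    τ := Functor.isoWhiskerRight e.u.asEquivalence.counitIso.symm N.right ≪≫
      Functor.isoWhiskerLeft e.u.inv e.τ.symm
    compat := fun y => by
      have key : ∀ {a b c s s' n n' : ℤˣ}, b * n' = s * c → a * n' = n * s' → (a * b) * s = n * (s' * c) := by
        decide
      have h1 := e.compat (e.u.inv.obj y)
      have h2 := N.sign_naturality (e.u.asEquivalence.counitIso.inv.app y)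
      refine (congrArg (· * _) (parity_comp (N.left.map (e.u.asEquivalence.counitIso.inv.app y))
        (e.σ.inv.app (e.u.inv.obj y)))).trans (Eq.trans ?_ (congrArg (N.sign y * ·)
        (parity_comp (N.right.map (e.u.asEquivalence.counitIso.inv.app y))
          (e.τ.inv.app (e.u.inv.obj y)))).symm)
      refine key (Eq.trans (congrArg (· * _) ?_) (h1.trans (congrArg (_ * ·) ?_))) h2
      · exact parity_iso_inv (e.σ.app (e.u.inv.obj y))
      · exact (parity_iso_inv (e.τ.app (e.u.inv.obj y))).symm }

def trans {M N P : PSpan I J} (e : Equivalence M N) (e' : Equivalence N P) : Equivalence M P :=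
  haveI := e.isEquivalence
  haveI := e'.isEquivalence
  { u := e.u ⋙ e'.u
    isEquivalence := inferInstance
    σ := e.σ ≪≫ Functor.isoWhiskerLeft e.u e'.σ
    τ := e.τ ≪≫ Functor.isoWhiskerLeft e.u e'.τ
    compat := fun x => by
      change parity (e.σ.hom.app x ≫ e'.σ.hom.app (e.u.obj x)) * P.sign (e'.u.obj (e.u.obj x)) =
        M.sign x * parity (e.τ.hom.app x ≫ e'.τ.hom.app (e.u.obj x))
      rw [parity_comp, parity_comp, mul_assoc, e'.compat, ← mul_assoc, e.compat, mul_assoc] }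

/-- Composition of spans respects equivalences. -/
def compCongr {M M' : PSpan I J} {N N' : PSpan J K} (e : Equivalence M M')
    (e' : Equivalence N N') : Equivalence (M.comp N) (M'.comp N') :=
  haveI := e.isEquivalence
  haveI := e'.isEquivalence
  let α : e.u ⋙ M'.right ⟶ M.right ⋙ 𝟭 _ := e.τ.inv
  let β : N.left ⋙ 𝟭 _ ⟶ e'.u ⋙ N'.left := e'.σ.hom
  haveI : IsIso α := inferInstanceAs (IsIso e.τ.inv)
  haveI : IsIso β := inferInstanceAs (IsIso e'.σ.hom)
  { u := Comma.map α β
    isEquivalence := Comma.isEquivalenceMap α β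
    σ := Functor.isoWhiskerLeft (Comma.fst M.right N.left) e.σ
    τ := Functor.isoWhiskerLeft (Comma.snd M.right N.left) e'.τ
    compat := fun (X : Comma M.right N.left) => by
      have h1 := e.compat X.left
      have h2 := e'.compat X.right
      have h3 := parity_iso_inv (e.τ.app X.left)
      simp only [Iso.app_inv, Iso.app_hom] at h3
      change parity (e.σ.hom.app X.left) * (M'.comp N').sign ((Comma.map α β).obj X) =
        (M.comp N).sign X * parity (e'.τ.hom.app X.right)
      rw [sign_comp, sign_comp]
      change parity (e.σ.hom.app X.left) * (M'.sign (e.u.obj X.left) *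
        parity (e.τ.inv.app X.left ≫ X.hom ≫ e'.σ.hom.app X.right) *
          N'.sign (e'.u.obj X.right)) = _
      rw [parity_comp, parity_comp, h3]
      calc _ = (parity (e.σ.hom.app X.left) * M'.sign (e.u.obj X.left)) *
            parity (e.τ.hom.app X.left) * parity X.hom *
            (parity (e'.σ.hom.app X.right) * N'.sign (e'.u.obj X.right)) := by
              simp only [mul_assoc]
        _ = _ := by
              rw [h1, h2, mul_assoc (M.sign X.left), Int.units_mul_self, mul_one]
              simp only [mul_assoc] }

/-- The left unit law, up to equivalence. -/
noncomputable def leftUnitor (M : PSpan I J) : Equivalence ((PSpan.id I).comp M) M where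
  u := Comma.snd (𝟭 I) M.left
  isEquivalence := isEquivalence_comma_snd M.left
  σ := commaIso (𝟭 I) M.left
  τ := Iso.refl _
  compat := fun (X : Comma (𝟭 I) M.left) => by
    change parity X.hom * M.sign X.right = ((PSpan.id I).comp M).sign X * parity (𝟙 _)
    rw [sign_comp (PSpan.id I) M X, parity_id, mul_one, sign_id, one_mul]

/-- The right unit law, up to equivalence. -/
noncomputable def rightUnitor (M : PSpan I J) : Equivalence (M.comp (PSpan.id J)) M where
  u := Comma.fst M.right (𝟭 J)
  isEquivalence := isEquivalence_comma_fst M.right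
  σ := Iso.refl _
  τ := (commaIso M.right (𝟭 J)).symm
  compat := fun (X : Comma M.right (𝟭 J)) => by
    let e : M.right.obj X.left ≅ X.right := (commaIso M.right (𝟭 J)).app X
    have h : parity e.inv = parity e.hom := parity_iso_inv e
    have h' : (M.comp (PSpan.id J)).sign X = M.sign X.left * parity e.hom * 1 :=
      sign_comp M (PSpan.id J) X
    change parity (𝟙 (M.left.obj X.left)) * M.sign X.left =
      (M.comp (PSpan.id J)).sign X * parity e.inv
    rw [h', h, parity_id, one_mul, mul_one, mul_assoc, Int.units_mul_self, mul_one]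

/-- Associativity of composition, up to equivalence. -/
def associator (M : PSpan I J) (N : PSpan J K) (P : PSpan K L) :
    Equivalence ((M.comp N).comp P) (M.comp (N.comp P)) where
  u := commaAssoc M.right N.left N.right P.left
  isEquivalence := isEquivalence_commaAssoc M.right N.left N.right P.left
  σ := Iso.refl _
  τ := Iso.refl _
  compat := fun (X : Comma (M.comp N).right P.left) => by
    let Y : Comma M.right (N.comp P).left :=
      ⟨X.left.left, ⟨X.left.right, X.right, X.hom⟩, X.left.hom⟩
    change parity (𝟙 _) * (M.comp (N.comp P)).sign Y = ((M.comp N).comp P).sign X * parity (𝟙 _)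
    rw [sign_comp M (N.comp P) Y, sign_comp (M.comp N) P X, sign_comp M N X.left,
      sign_comp N P Y.right, parity_id, parity_id, one_mul, mul_one]
    simp only [mul_assoc, Y]

end Equivalence

/-- Equivalence of spans as an equivalence relation. -/
instance setoid (I J : ParityGroupoid.{u}) : Setoid (PSpan I J) where
  r M N := Nonempty (Equivalence M N)
  iseqv := ⟨fun M => ⟨.refl M⟩, fun ⟨e⟩ => ⟨e.symm⟩, fun ⟨e⟩ ⟨e'⟩ => ⟨e.trans e'⟩⟩

end PSpan

/-- The category `lin^±`. An object is a finite groupoid `T` with parity structure, standing for the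
slice `𝒵_{/T}`. -/
structure LinPM : Type (u + 1) where
  base : ParityGroupoid.{u}

/-- Morphisms of `lin^±` are `𝐏`-spans up to equivalence (linear functors between slices up to
natural equivalence); composition is by homotopy pullback. -/
instance : Category.{u + 1} LinPM.{u} where
  Hom I J := Quotient (PSpan.setoid I.base J.base)
  id I := Quotient.mk _ (PSpan.id I.base)
  comp := Quotient.map₂ PSpan.comp fun _ _ ⟨e⟩ _ _ ⟨e'⟩ => ⟨e.compCongr e'⟩
  id_comp := by rintro _ _ ⟨M⟩; exact Quotient.sound ⟨.leftUnitor M⟩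
  comp_id := by rintro _ _ ⟨M⟩; exact Quotient.sound ⟨.rightUnitor M⟩
  assoc := by rintro _ _ _ _ ⟨M⟩ ⟨N⟩ ⟨P⟩; exact Quotient.sound ⟨.associator M N P⟩

/-- The morphism of `lin^±` given by a `𝐏`-span. -/
def PSpan.toHom {I J : LinPM.{u}} (M : PSpan I.base J.base) : I ⟶ J := Quotient.mk _ M

/-! ## Scalars, fibres, and the cardinality matrix -/

/-- A scalar is a `𝐏`-span from `𝖾` to `𝖾`. -/
abbrev PScalar : Type (u + 1) := PSpan ParityGroupoid.unit.{u} ParityGroupoid.unit.{u}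

/-- The cardinality of a scalar `S`: the homotopy cardinality of the positive part minus that of the
negative part. -/
noncomputable def PScalar.card (S : PScalar.{u}) : ℚ :=
  homotopyCard (ObjectProperty.FullSubcategory (fun x : S.apex => S.sign x = 1)) -
    homotopyCard (ObjectProperty.FullSubcategory (fun x : S.apex => S.sign x = -1))

namespace PSpan

variable {I J : ParityGroupoid.{u}}

/-- The elementary state `1 ← 1 → I` at a point `i`, with trivial `2`-cell. -/
abbrev name (i : I) : PSpan ParityGroupoid.unit.{u} I where
  apex := ParityGroupoid.unit.{u}
  left := 𝟭 _
  right := (Functor.const _).obj i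
  rho :=
    { app := fun _ => (1 : ℤˣ)
      naturality := fun x y f => by
        change (1 : ℤˣ) * 1 = parity (𝟙 i) * 1
        simp }

/-- The dual costate `I ← 1 → 1` of an elementary state. -/
abbrev coname (i : I) : PSpan I ParityGroupoid.unit.{u} where
  apex := ParityGroupoid.unit.{u}
  left := (Functor.const _).obj i
  right := 𝟭 _
  rho :=
    { app := fun _ => (1 : ℤˣ)
      naturality := fun x y f => by
        change (1 : ℤˣ) * parity (𝟙 i) = 1 * 1
        simp }

/-- The two-sided fibre `ᵢMⱼ` as a scalar, computed by homotopy pullbacks. -/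
abbrev fibre (M : PSpan I J) (i : I) (j : J) : PScalar.{u} := ((name i).comp M).comp (coname j)

theorem fibre_w (M : PSpan I J) {i : I} {j : J} {X Y : (M.fibre i j).apex} (f : X ⟶ Y) :
    M.right.map f.left.right ≫ Y.hom = X.hom :=
  f.w.trans (Category.comp_id _)

/-- A point of the groupoid `ᵢMⱼ` is given by a point `m` of `M`, an arrow `i ⟶ p m` and an arrow
`b : q m ⟶ j`. The automorphism group `j!` acts on the right on these points by `b ↦ b ≫ g`. -/
abbrev fibreActObj (M : PSpan I J) (i : I) (j : J) (X : (M.fibre i j).apex) (g : j ≅ j) :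
    (M.fibre i j).apex :=
  { left := X.left, right := X.right, hom := X.hom ≫ g.hom }

/-- The action of `j!` on the arrows of `ᵢMⱼ`: the underlying arrow of the apex does not change. -/
abbrev fibreActMap (M : PSpan I J) (i : I) (j : J) {X Y : (M.fibre i j).apex} (f : X ⟶ Y)
    (g : j ≅ j) : M.fibreActObj i j X g ⟶ M.fibreActObj i j Y g :=
  { left := f.left
    right := f.right
    w := by
      refine Eq.trans ?_ (Category.comp_id _).symm
      exact (Category.assoc _ _ _).symm.trans (congrArg (· ≫ g.hom) (M.fibre_w f)) }

/-- The underlying groupoid of the weak quotient `ᵢMⱼ / j!`. Its points are those of `ᵢMⱼ`. -/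
structure FibreQuot (M : PSpan I J) (i : I) (j : J) : Type u where
  point : (M.fibre i j).apex

namespace FibreQuot

variable {M : PSpan I J} {i : I} {j : J}

/-- An arrow `x → y` of the weak quotient is a pair of a group element `g` (a new arrow `x → x.g`)
and an arrow `x.g ⟶ y` of `ᵢMⱼ` (an old arrow). -/
structure Hom (X Y : FibreQuot M i j) : Type u where
  g : j ≅ j
  old : M.fibreActObj i j X.point g ⟶ Y.point

theorem Hom.ext {X Y : FibreQuot M i j} {f f' : Hom X Y} (hg : f.g = f'.g)
    (h : f.old.left.right = f'.old.left.right) : f = f' := by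
  obtain ⟨g, a⟩ := f
  obtain ⟨g', a'⟩ := f'
  obtain rfl : g = g' := hg
  have : a = a' := CommaMorphism.ext (CommaMorphism.ext (Subsingleton.elim (α := Discrete.mk _ ⟶ _) _ _) h)
    (Subsingleton.elim (α := Discrete.mk _ ⟶ _) _ _)
  rw [this]

/-- The composite of `x → x.g → y` and `y → y.h → z` is `x → x.(gh) = (x.g).h → y.h → z`. -/
instance : Category.{u} (FibreQuot M i j) where
  Hom := Hom
  id X :=
    { g := Iso.refl j
      old :=
        { left := 𝟙 X.point.left
          right := 𝟙 X.point.right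
          w := by
            refine Eq.trans ?_ (Category.comp_id _).symm
            exact (congrArg (· ≫ X.point.hom) (M.right.map_id _)).trans
              ((Category.id_comp _).trans (Category.comp_id _).symm) } }
  comp {X _ _} f f' :=
    { g := f.g ≪≫ f'.g
      old :=
        { left := (M.fibreActMap i j f.old f'.g).left ≫ f'.old.left
          right := (M.fibreActMap i j f.old f'.g).right ≫ f'.old.right
          w := by
            have h := (M.fibreActMap i j f.old f'.g ≫ f'.old).w
            refine h.trans ((Category.comp_id _).trans (Eq.trans ?_ (Category.comp_id _).symm))
            exact Category.assoc _ _ _ } }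
  id_comp f := Hom.ext (Iso.refl_trans f.g) (Category.id_comp _)
  comp_id f := Hom.ext (Iso.trans_refl f.g) (Category.comp_id _)
  assoc f f' f'' := Hom.ext (Iso.trans_assoc f.g f'.g f''.g) (Category.assoc _ _ _)

/-- The inclusion of `ᵢMⱼ` into the weak quotient, by the old arrows. -/
def incl (M : PSpan I J) (i : I) (j : J) : (M.fibre i j).apex ⥤ FibreQuot M i j where
  obj X := ⟨X⟩
  map {X _} f :=
    { g := Iso.refl j
      old :=
        { left := f.left
          right := f.right
          w := f.w.trans (congrArg (· ≫ 𝟙 j) (Category.comp_id X.hom).symm) } }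
  map_id _ := Hom.ext rfl rfl
  map_comp _ _ := Hom.ext (Iso.refl_trans _).symm rfl

instance : IsGroupoid (FibreQuot M i j) where
  all_isIso {X Y} f := by
    let f₁ : Hom X Y := f
    have : IsGroupoid (M.fibre i j).apex := (M.fibre i j).isGroupoid
    let k : Y.point ⟶ M.fibreActObj i j X.point f₁.g := inv f₁.old
    refine ⟨⟨f₁.g.symm, ⟨k.left, k.right, ?_⟩⟩, ?_, ?_⟩
    · refine Eq.trans ?_ (Category.comp_id _).symm
      have h : M.right.map k.left.right ≫ X.point.hom ≫ f₁.g.hom = Y.point.hom := M.fibre_w k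
      exact (Iso.eq_comp_inv f₁.g).2 ((Category.assoc _ _ _).trans h)
    · refine Hom.ext (Iso.self_symm_id f₁.g) ?_
      exact congrArg (fun l => l.left.right) (IsIso.hom_inv_id f₁.old)
    · refine Hom.ext (Iso.symm_self_id f₁.g) ?_
      exact congrArg (fun l => l.left.right) (IsIso.inv_hom_id f₁.old)

instance : HFinite (FibreQuot M i j) where
  finite_pi0 := by
    refine Finite.of_surjective (α := Pi0 (M.fibre i j).apex)
      (Quotient.map' (s₁ := isIsomorphicSetoid _) (s₂ := isIsomorphicSetoid _) (incl M i j).obj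
        fun x y ⟨e⟩ => ⟨(incl M i j).mapIso e⟩) ?_
    rintro ⟨X⟩
    exact ⟨Pi0.mk X.point, rfl⟩
  finite_hom X Y := by
    have : Finite (j ≅ j) := Finite.of_injective (fun e => e.hom) fun e e' h => Iso.ext h
    refine Finite.of_injective (fun f : Hom X Y => ((f.g, f.old.left.right) :
      (j ≅ j) × (X.point.left.right ⟶ Y.point.left.right))) fun f f' h => ?_
    exact Hom.ext (congrArg Prod.fst h) (congrArg Prod.snd h)

end FibreQuot

theorem sign_fibre (M : PSpan I J) (i : I) (j : J) (X : (M.fibre i j).apex) :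
    (M.fibre i j).sign X = parity X.left.hom * M.sign X.left.right * parity X.hom := by
  have h1 := sign_comp ((name i).comp M) (coname j) X
  have h2 := sign_comp (name i) M X.left
  refine h1.trans ?_
  rw [h2]
  exact (mul_one _).trans (congrArg (· * _) (congrArg (· * _) (one_mul _)))

/-- An arrow of a scalar does not change the sign. -/
theorem sign_eq_of_hom (S : PScalar.{u}) {x y : S.apex} (f : x ⟶ y) : S.sign x = S.sign y := by
  have h := S.sign_naturality f
  exact ((mul_one _).symm.trans (h.symm.trans (one_mul _)))

/-- If `j` is orientable, the action of `j!` on `ᵢMⱼ` preserves the signs. -/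
theorem sign_fibreActObj (M : PSpan I J) (i : I) (j : J) (hj : IsOrientable J j)
    (X : (M.fibre i j).apex) (g : j ≅ j) :
    (M.fibre i j).sign (M.fibreActObj i j X g) = (M.fibre i j).sign X := by
  rw [sign_fibre, sign_fibre]
  refine congrArg (_ * ·) ((parity_comp _ _).trans ?_)
  rw [hj g.hom, mul_one]

/-- The scalar `ᵢMⱼ / j!`, for an orientable point `j`: the weak quotient of the scalar `ᵢMⱼ` by
the action of `j!`. The sign of a point is its sign in `ᵢMⱼ`. -/
def fibreQuot (M : PSpan I J) (i : I) (j : J) (hj : IsOrientable J j) : PScalar.{u} where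
  apex := FibreQuot M i j
  left := (Functor.const _).obj ⟨PUnit.unit⟩
  right := (Functor.const _).obj ⟨PUnit.unit⟩
  rho :=
    { app := fun X => (M.fibre i j).sign X.point
      naturality := fun X Y (f : FibreQuot.Hom X Y) => by
        change (M.fibre i j).sign Y.point * 1 = 1 * (M.fibre i j).sign X.point
        rw [mul_one, one_mul, ← M.sign_fibreActObj i j hj X.point f.g]
        exact (sign_eq_of_hom (M.fibre i j) f.old).symm }

end PSpan

/-- A choice of a point in every connected component of the orientable locus `T°`, that is, a choice
of an elementary state for every orientable component of `T`. -/
structure BasisChoice (T : ParityGroupoid.{u}) where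
  pt : Pi0 T.OrientableLocus → T.OrientableLocus
  mk_pt : ∀ c, Pi0.mk (pt c) = c

/-- The vector space `ℚ_{π₀ T°}` spanned by the components of the orientable locus. -/
abbrev cardSpace (T : ParityGroupoid.{u}) : Type u := Pi0 T.OrientableLocus →₀ ℚ

namespace PSpan

variable {I J : ParityGroupoid.{u}}

/-- The cardinality matrix `[M]`, indexed by `π₀ I°` and `π₀ J°`, with entries `‖ᵢMⱼ / j!‖`. -/
noncomputable def cardMatrix (bI : BasisChoice I) (bJ : BasisChoice J) (M : PSpan I J) :
    Matrix (Pi0 I.OrientableLocus) (Pi0 J.OrientableLocus) ℚ :=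
  Matrix.of fun i j => PScalar.card (M.fibreQuot (bI.pt i).obj (bJ.pt j).obj (bJ.pt j).property)

/-- The linear map `ℚ_{π₀ I°} → ℚ_{π₀ J°}` with matrix `[M]`: it sends the basis vector of `i` to
`∑ⱼ [M]ᵢⱼ eⱼ`. -/
noncomputable def cardMap (bI : BasisChoice I) (bJ : BasisChoice J) (M : PSpan I J) :
    cardSpace I →ₗ[ℚ] cardSpace J :=
  Finsupp.linearCombination ℚ fun i => ∑ j, Finsupp.single j (M.cardMatrix bI bJ i j)

end PSpan

/-! ## Sums over groupoids -/

/-! Everything reduces to signed counts of arrows: write s(x, y) for the sum of the parities of all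
arrows from x to y (`signedHom`). Translating by an arrow f multiplies s by the parity of f. In
particular an odd automorphism of x or y gives s = -s, so s vanishes as soon as one end is not
orientable.

A fibre is controlled by its points (m, a, b). Arrows of the apex lift uniquely to the fibre, so
summing signs over all a and b gives the cardinality of ᵢMⱼ as the sum over m of s(i, p m) · ρ_m ·
s(q m, j) / |Aut m| (`card_fibre`). The quotient by j! has |j!| times as many arrows, which divides
this by |j!| (`card_fibreQuot`). The vanishing at non-orientable points is then immediate.

For a composite, the sum over the middle arrow a : q m ⟶ p n of its parity is s(q m, p n).
Functoriality is the identity s(y, z) = ∑ s(y, j) s(j, z) / |j!| over representatives j of the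
orientable components (`sum_basisChoice_signedHom_mul`): every arrow from y to j transports s(j, z)
to s(y, z), and non-orientable y gives zero on both sides. The factor 1 / |j!| is exactly the one in
the entry of the first matrix.

To avoid choosing one point per component in fibres and pullbacks, sums run over any finite family
meeting every component, with weight 1 / `outDegree`. If n members lie in the component of x, the
out-degree of x is n · |Aut x|, so repetitions are compensated (`homotopyCard_eq_sum`). -/

noncomputable instance homFintype {C : Type*} [Category C] [HFinite C] (x y : C) :
    Fintype (x ⟶ y) :=
  Fintype.ofFinite _

section Sums

variable {C : Type*} [Category C] [IsGroupoid C]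

theorem Pi0.mk_eq_mk_iff {x y : C} : Pi0.mk x = Pi0.mk y ↔ Nonempty (x ⟶ y) :=
  ⟨fun h => (Pi0.exact h).map Iso.hom, fun ⟨f⟩ => Pi0.sound (asIso f)⟩

/-- An arrow `y ⟶ x` identifies the arrows out of `x` with those out of `y`. -/
noncomputable def precompEquiv {x y : C} (f : y ⟶ x) (z : C) : (x ⟶ z) ≃ (y ⟶ z) where
  toFun h := f ≫ h
  invFun h := inv f ≫ h
  left_inv h := by simp
  right_inv h := by simp

/-- An arrow `x ⟶ y` identifies the arrows into `x` with those into `y`. -/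
noncomputable def postcompEquiv {x y : C} (f : x ⟶ y) (z : C) : (z ⟶ x) ≃ (z ⟶ y) where
  toFun h := h ≫ f
  invFun h := h ≫ inv f
  left_inv h := by simp
  right_inv h := by simp

variable (C) in
theorem natCard_aut [HFinite C] (x : C) : Nat.card (Aut x) = Fintype.card (x ⟶ x) := by
  rw [← Nat.card_eq_fintype_card]
  exact Nat.card_congr
    ⟨fun e => e.hom, fun f => asIso f, fun e => Iso.ext rfl, fun f => rfl⟩

variable [HFinite C] {ι : Type*} [Fintype ι]

/-- The number of arrows from `y` to the members of a finite family of points. -/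
noncomputable def outDegree (o : ι → C) (y : C) : ℕ := ∑ x, Fintype.card (y ⟶ o x)

theorem outDegree_congr (o : ι → C) {x y : C} (f : y ⟶ x) : outDegree o x = outDegree o y :=
  Finset.sum_congr rfl fun z _ => Fintype.card_congr (precompEquiv f (o z))

/-- A family of points meeting every component computes weighted sums: the members of the family in
the component of `y` have total weight `1`. -/
theorem sum_card_hom_div_outDegree (o : ι → C) (y : C) (hy : ∃ x, Nonempty (y ⟶ o x)) :
    ∑ x, (Fintype.card (y ⟶ o x) : ℚ) / outDegree o (o x) = 1 := by
  -- The denominator may be replaced by the out-degree of `y`: the two agree in the component of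
  -- `y`, and elsewhere the numerator is zero.
  have h : ∀ x, (Fintype.card (y ⟶ o x) : ℚ) / outDegree o (o x) =
      (Fintype.card (y ⟶ o x) : ℚ) / outDegree o y := by
    intro x
    rcases isEmpty_or_nonempty (y ⟶ o x) with h | ⟨⟨f⟩⟩
    · simp
    · rw [outDegree_congr o f]
  rw [Finset.sum_congr rfl fun x _ => h x, ← Finset.sum_div, outDegree, Nat.cast_sum]
  refine div_self (ne_of_gt ?_)
  obtain ⟨x, hx⟩ := hy
  refine Finset.sum_pos' (fun _ _ => Nat.cast_nonneg _) ⟨x, Finset.mem_univ _, ?_⟩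
  exact_mod_cast Fintype.card_pos

/-- Double counting of arrows from component representatives to members of the family: summed over
the family with weights they give 1, and summed over the components, each divided by the
automorphisms of its representative, they give 1 as well. -/
theorem homotopyCard_eq_sum (o : ι → C) (ho : ∀ y, ∃ x, Nonempty (y ⟶ o x)) :
    homotopyCard C = ∑ x, 1 / (outDegree o (o x) : ℚ) := by
  classical
  have hout : ∀ (x : ι), ∑ c : Pi0 C, (Fintype.card (c.out ⟶ o x) : ℚ) /
      Fintype.card (c.out ⟶ c.out) = 1 := by
    intro x
    rw [Finset.sum_eq_single (Pi0.mk (o x))]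
    · obtain ⟨e⟩ := Pi0.exact (Pi0.mk_out (Pi0.mk (o x)))
      rw [Fintype.card_congr (postcompEquiv e.hom _)]
      refine div_self ?_
      have : Nonempty ((Pi0.mk (o x)).out ⟶ o x) := ⟨e.hom⟩
      exact_mod_cast Fintype.card_ne_zero
    · intro c _ hc
      have : IsEmpty (c.out ⟶ o x) := by
        refine ⟨fun f => hc ?_⟩
        rw [← Pi0.mk_eq_mk_iff.2 ⟨f⟩, Pi0.mk_out]
      simp
    · simp
  calc homotopyCard C
      = ∑ c : Pi0 C, 1 / (Fintype.card (c.out ⟶ c.out) : ℚ) *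
          ∑ x, (Fintype.card (c.out ⟶ o x) : ℚ) / outDegree o (o x) := by
        refine Finset.sum_congr rfl fun c _ => ?_
        rw [sum_card_hom_div_outDegree o _ (ho _), mul_one, natCard_aut]
    _ = ∑ x, 1 / (outDegree o (o x) : ℚ) *
          ∑ c : Pi0 C, (Fintype.card (c.out ⟶ o x) : ℚ) / Fintype.card (c.out ⟶ c.out) := by
        simp only [Finset.mul_sum]
        rw [Finset.sum_comm]
        refine Finset.sum_congr rfl fun x _ => Finset.sum_congr rfl fun c _ => ?_
        ring
    _ = _ := Finset.sum_congr rfl fun x _ => by rw [hout, mul_one]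

/-- A property stable under arrows cuts out a union of components, so the members of the family
satisfying it still meet every remaining component, and their out-degrees do not change. -/
theorem homotopyCard_fullSubcategory (P : ObjectProperty C) [DecidablePred P]
    (hP : ∀ {x y : C}, (x ⟶ y) → P x → P y)
    (o : ι → C) (ho : ∀ y, ∃ x, Nonempty (y ⟶ o x)) :
    homotopyCard P.FullSubcategory = ∑ x, if P (o x) then 1 / (outDegree o (o x) : ℚ) else 0 := by
  have : IsGroupoid P.FullSubcategory :=
    ⟨fun {X Y} f => (P.isoMk (asIso f.hom) : X ≅ Y).isIso_hom⟩
  let o' : {x // P (o x)} → P.FullSubcategory := fun x => ⟨o x.1, x.2⟩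
  rw [homotopyCard_eq_sum o', ← Finset.sum_filter]
  · rw [Finset.sum_subtype (p := fun x => P (o x)) _ (by simp)]
    refine Finset.sum_congr rfl fun x _ => ?_
    congr 2
    have h : ∀ y : {x // P (o x)}, Fintype.card (o' x ⟶ o' y) = Fintype.card (o x ⟶ o y) :=
      fun y => Fintype.card_congr
        ⟨fun f => f.hom, fun f => ObjectProperty.homMk f, fun f => rfl, fun f => rfl⟩
    rw [outDegree, Finset.sum_congr rfl fun y _ => h y, outDegree]
    -- Targets outside `P` receive no arrow from a point of `P`, so dropping them loses nothing.
    rw [← Finset.sum_filter_of_ne (p := fun y => P (o y)),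
      Finset.sum_subtype (p := fun y => P (o y)) _ (by simp)]
    intro y _ hy
    obtain ⟨f⟩ := Fintype.card_pos_iff.1 (Nat.pos_of_ne_zero hy)
    exact hP f x.2
  · intro y
    obtain ⟨x, ⟨f⟩⟩ := ho y.obj
    exact ⟨⟨x, hP f y.property⟩, ⟨ObjectProperty.homMk f⟩⟩

end Sums

/-! ## Signed sums -/

/-- The rational value of a sign. -/
def signVal : ℤˣ →* ℚ := (Int.castRingHom ℚ : ℤ →* ℚ).comp (Units.coeHom ℤ)

@[simp] theorem signVal_neg_one : signVal (-1) = -1 := by simp [signVal]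

/-- The sign is constant on components, so one family computes both the positive and the negative
part with the same weights. -/
theorem PScalar.card_eq_sum (S : PScalar.{u}) {ι : Type*} [Fintype ι] (o : ι → S.apex)
    (ho : ∀ y, ∃ x, Nonempty (y ⟶ o x)) :
    PScalar.card S = ∑ x, signVal (S.sign (o x)) / (outDegree o (o x) : ℚ) := by
  classical
  rw [PScalar.card,
    homotopyCard_fullSubcategory (fun x => S.sign x = 1)
      (fun f h => (PSpan.sign_eq_of_hom S f).symm.trans h) o ho,
    homotopyCard_fullSubcategory (fun x => S.sign x = -1)
      (fun f h => (PSpan.sign_eq_of_hom S f).symm.trans h) o ho, ← Finset.sum_sub_distrib]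
  refine Finset.sum_congr rfl fun x _ => ?_
  have h11 : (1 : ℤˣ) ≠ -1 := by decide
  rcases Int.units_eq_one_or (S.sign (o x)) with h | h
  · simp [h, h11]
  · simp [h, h11.symm, neg_div]

/-! ### Signed counts of arrows -/

namespace ParityGroupoid

variable {T : ParityGroupoid.{u}}

/-- The signed number of arrows from `x` to `y`. -/
noncomputable def signedHom (x y : T) : ℚ := ∑ h : x ⟶ y, signVal (parity h)

/-- Precomposition with `f` is a bijection of hom-sets that multiplies every parity by that of `f`.
-/
theorem signedHom_congr_left {x y : T} (f : y ⟶ x) (z : T) :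
    signedHom y z = signVal (parity f) * signedHom x z := by
  rw [signedHom, signedHom, Finset.mul_sum, ← (precompEquiv f z).sum_comp]
  exact Finset.sum_congr rfl fun h _ => by
    rw [← map_mul, ← parity_comp]; rfl

theorem signedHom_congr_right {x y : T} (f : x ⟶ y) (z : T) :
    signedHom z y = signedHom z x * signVal (parity f) := by
  rw [signedHom, signedHom, Finset.sum_mul, ← (postcompEquiv f z).sum_comp]
  exact Finset.sum_congr rfl fun h _ => by
    rw [← map_mul, ← parity_comp]; rfl

theorem exists_odd {x : T} (hx : ¬ IsOrientable T x) : ∃ f : x ⟶ x, parity f = -1 := by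
  simp only [IsOrientable, not_forall] at hx
  obtain ⟨f, hf⟩ := hx
  exact ⟨f, (Int.units_eq_one_or _).resolve_left hf⟩

/-- Translation by an odd automorphism pairs the signs off: the count equals its own negative. -/
theorem signedHom_of_not_orientable_left {x : T} (hx : ¬ IsOrientable T x) (y : T) :
    signedHom x y = 0 := by
  obtain ⟨f, hf⟩ := exists_odd hx
  have h := signedHom_congr_left f y
  rw [hf, signVal_neg_one] at h
  linarith

theorem signedHom_of_not_orientable_right {y : T} (hy : ¬ IsOrientable T y) (x : T) :
    signedHom x y = 0 := by
  obtain ⟨f, hf⟩ := exists_odd hy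
  have h := signedHom_congr_right f x
  rw [hf, signVal_neg_one] at h
  linarith

theorem signedHom_self {x : T} (hx : IsOrientable T x) :
    signedHom x x = Fintype.card (x ⟶ x) := by
  simp [signedHom, hx _]

theorem signedHom_of_isEmpty {x y : T} (h : IsEmpty (x ⟶ y)) : signedHom x y = 0 := by
  simp [signedHom]

/-- Inserting a sum over a family of intermediate points. -/
theorem sum_signedHom_mul {ι : Type*} [Fintype ι] (o : ι → T) (y z : T)
    (hy : ∃ x, Nonempty (y ⟶ o x)) :
    ∑ x, signedHom y (o x) * signedHom (o x) z / outDegree o (o x) = signedHom y z := by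
  -- For each arrow from `y` to `o x`, its sign times the count out of `o x` is the count out of
  -- `y`; only the unsigned number of such arrows remains.
  have h : ∀ x, signedHom y (o x) * signedHom (o x) z =
      Fintype.card (y ⟶ o x) * signedHom y z := by
    intro x
    rw [signedHom, Finset.sum_mul,
      Finset.sum_congr rfl fun f _ => (signedHom_congr_left f z).symm]
    simp
  rw [Finset.sum_congr rfl fun x _ => congrArg (· / _) (h x)]
  simp only [mul_div_right_comm]
  rw [← Finset.sum_mul, sum_card_hom_div_outDegree o y hy, one_mul]

/-- Only the orientable intermediate points contribute. -/
theorem sum_basisChoice_signedHom_mul (b : BasisChoice T) (y z : T) :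
    ∑ c, signedHom y (b.pt c).obj * signedHom (b.pt c).obj z /
      Fintype.card ((b.pt c).obj ⟶ (b.pt c).obj) = signedHom y z := by
  by_cases hy : IsOrientable T y
  · rw [← sum_signedHom_mul (fun c => (b.pt c).obj) y z]
    · refine Finset.sum_congr rfl fun c _ => ?_
      -- Distinct basis points lie in distinct components, so the out-degree of a basis point in the
      -- family is the number of its endomorphisms.
      congr 2
      rw [outDegree, Finset.sum_eq_single c]
      · intro c' _ hc
        have : IsEmpty ((b.pt c).obj ⟶ (b.pt c').obj) := by
          refine ⟨fun f => hc ?_⟩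
          rw [← b.mk_pt c, ← b.mk_pt c']
          exact (Pi0.sound (ObjectProperty.isoMk _ (asIso f))).symm
        simp
      · simp
    -- The basis points need not meet every component of `T`; it suffices that one lies in the
    -- component of the orientable point `y`.
    · let y' : T.OrientableLocus := ⟨y, hy⟩
      obtain ⟨e⟩ := Pi0.exact (b.mk_pt (Pi0.mk y'))
      exact ⟨Pi0.mk y', ⟨e.inv.hom⟩⟩
  · simp [signedHom_of_not_orientable_left hy]

end ParityGroupoid

namespace PSpan

variable {I J K : ParityGroupoid.{u}}

/-! ## The cardinalities of the fibres -/

/-- The point of `ᵢMⱼ` given by a point `m` and arrows `i ⟶ p m` and `q m ⟶ j`. -/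
def fibrePoint (M : PSpan I J) {i : I} {j : J} (m : M.apex) (a : i ⟶ M.left.obj m)
    (b : M.right.obj m ⟶ j) : (M.fibre i j).apex :=
  { left := { left := ⟨PUnit.unit⟩, right := m, hom := a }
    right := ⟨PUnit.unit⟩
    hom := b }

theorem sign_fibrePoint (M : PSpan I J) {i : I} {j : J} (m : M.apex) (a : i ⟶ M.left.obj m)
    (b : M.right.obj m ⟶ j) :
    (M.fibre i j).sign (M.fibrePoint m a b) = parity a * M.sign m * parity b :=
  M.sign_fibre i j _

/-- An arrow of `ᵢMⱼ` is an arrow of the apex compatible with the two structure arrows. -/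
def fibreHomEquiv (M : PSpan I J) {i : I} {j : J} {m n : M.apex} (a : i ⟶ M.left.obj m)
    (b : M.right.obj m ⟶ j) (a' : i ⟶ M.left.obj n) (b' : M.right.obj n ⟶ j) :
    (M.fibrePoint m a b ⟶ M.fibrePoint n a' b') ≃
      {f : m ⟶ n // a ≫ M.left.map f = a' ∧ M.right.map f ≫ b' = b} where
  toFun f := ⟨f.left.right,
    (f.left.w.symm.trans (Category.id_comp _)), M.fibre_w f⟩
  invFun f :=
    { left :=
        { left := 𝟙 _
          right := f.1
          w := (Category.id_comp _).trans f.2.1.symm }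
      right := 𝟙 _
      w := f.2.2.trans (Category.comp_id _).symm }
  left_inv _ := CommaMorphism.ext
    (CommaMorphism.ext (Subsingleton.elim (α := Discrete.mk _ ⟶ _) _ _) rfl)
    (Subsingleton.elim (α := Discrete.mk _ ⟶ _) _ _)
  right_inv _ := rfl

/-- An arrow of `ᵢMⱼ / j!` is an arrow of the apex and a group element, compatible with the two
structure arrows. -/
def fibreQuotHomEquiv (M : PSpan I J) {i : I} {j : J} {m n : M.apex} (a : i ⟶ M.left.obj m)
    (b : M.right.obj m ⟶ j) (a' : i ⟶ M.left.obj n) (b' : M.right.obj n ⟶ j) :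
    ((⟨M.fibrePoint m a b⟩ : FibreQuot M i j) ⟶ ⟨M.fibrePoint n a' b'⟩) ≃
      Σ g : j ≅ j, {f : m ⟶ n // a ≫ M.left.map f = a' ∧ M.right.map f ≫ b' = b ≫ g.hom} where
  toFun f := ⟨f.g, M.fibreHomEquiv a (b ≫ f.g.hom) a' b' f.old⟩
  invFun f := ⟨f.1, (M.fibreHomEquiv a (b ≫ f.1.hom) a' b').symm f.2⟩
  left_inv _ := FibreQuot.Hom.ext rfl rfl
  right_inv _ := rfl

/-- Transporting both structure arrows along an arrow of the apex shows that the fibre points over a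
family meeting every component again form such a family. -/
theorem exists_hom_fibrePoint (M : PSpan I J) {i : I} {j : J} {ι : Type*} {o : ι → M.apex}
    (ho : ∀ y, ∃ x, Nonempty (y ⟶ o x)) (X : (M.fibre i j).apex) :
    ∃ x : Σ x, (i ⟶ M.left.obj (o x)) × (M.right.obj (o x) ⟶ j),
      Nonempty (X ⟶ M.fibrePoint (o x.1) x.2.1 x.2.2) := by
  obtain ⟨x, ⟨f⟩⟩ := ho X.left.right
  refine ⟨⟨x, (show i ⟶ _ from X.left.hom) ≫ M.left.map f,
    inv (M.right.map f) ≫ (show _ ⟶ j from X.hom)⟩,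
    ⟨(M.fibreHomEquiv X.left.hom X.hom _ _).symm ⟨f, rfl, IsIso.hom_inv_id_assoc _ _⟩⟩⟩

/-- Every arrow of the apex out of `m` lifts uniquely to an arrow of a fibre out of a given point
over `m`. -/
theorem card_sigma_lifts (M : PSpan I J) {i : I} {j : J} {m n : M.apex} (a : i ⟶ M.left.obj m)
    (b : M.right.obj m ⟶ j) :
    Nat.card (Σ c : (i ⟶ M.left.obj n) × (M.right.obj n ⟶ j),
      {f : m ⟶ n // a ≫ M.left.map f = c.1 ∧ M.right.map f ≫ c.2 = b}) =
      Fintype.card (m ⟶ n) := by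
  rw [← Nat.card_eq_fintype_card]
  refine Nat.card_congr ⟨fun f => f.2.1,
    fun f => ⟨⟨a ≫ M.left.map f, inv (M.right.map f) ≫ b⟩, f, rfl, by simp⟩, ?_, fun f => rfl⟩
  rintro ⟨⟨a', b'⟩, f, h, h'⟩
  obtain rfl : a ≫ M.left.map f = a' := h
  obtain rfl : inv (M.right.map f) ≫ b = b' := by rw [IsIso.inv_comp_eq]; exact h'.symm
  rfl

variable {ι : Type*} [Fintype ι]

/-- Since the family contains all pairs of structure arrows over each `o x`, the sum of signs
factors into two signed counts. -/
theorem card_fibre (M : PSpan I J) (i : I) (j : J) (o : ι → M.apex)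
    (ho : ∀ y, ∃ x, Nonempty (y ⟶ o x)) :
    PScalar.card (M.fibre i j) =
      ∑ x, signedHom i (M.left.obj (o x)) * signVal (M.sign (o x)) *
        signedHom (M.right.obj (o x)) j / outDegree o (o x) := by
  rw [PScalar.card_eq_sum _ _ (M.exists_hom_fibrePoint ho), Fintype.sum_sigma]
  refine Finset.sum_congr rfl fun x _ => ?_
  rw [Fintype.sum_prod_type, signedHom, signedHom, Finset.sum_mul, Finset.sum_mul, Finset.sum_div]
  refine Finset.sum_congr rfl fun a _ => ?_
  rw [Finset.mul_sum, Finset.sum_div]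
  refine Finset.sum_congr rfl fun b _ => ?_
  rw [sign_fibrePoint, map_mul, map_mul]
  congr 2
  -- By unique lifting, the out-degree of a fibre point is that of its underlying point in the apex.
  rw [outDegree, outDegree, Fintype.sum_sigma]
  refine Finset.sum_congr rfl fun y _ => ?_
  rw [← M.card_sigma_lifts a b, Nat.card_sigma]
  exact Finset.sum_congr rfl fun c _ => by
    rw [← Nat.card_eq_fintype_card, Nat.card_congr (M.fibreHomEquiv a b c.1 c.2)]

/-- The points and signs are those of the fibre; only the out-degrees change, by the factor |j!|. -/
theorem card_fibreQuot (M : PSpan I J) (i : I) (j : J) (hj : IsOrientable J j) (o : ι → M.apex)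
    (ho : ∀ y, ∃ x, Nonempty (y ⟶ o x)) :
    PScalar.card (M.fibreQuot i j hj) =
      ∑ x, signedHom i (M.left.obj (o x)) * signVal (M.sign (o x)) *
        signedHom (M.right.obj (o x)) j / outDegree o (o x) / Fintype.card (j ⟶ j) := by
  have : Finite (j ≅ j) := Finite.of_injective (fun e => e.hom) fun e e' h => Iso.ext h
  have := Fintype.ofFinite (j ≅ j)
  let o' : (Σ x, (i ⟶ M.left.obj (o x)) × (M.right.obj (o x) ⟶ j)) →
    (M.fibreQuot i j hj).apex := fun x => ⟨M.fibrePoint (o x.1) x.2.1 x.2.2⟩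
  have ho' : ∀ y, ∃ x, Nonempty (y ⟶ o' x) := fun y =>
    (M.exists_hom_fibrePoint ho y.point).imp fun x ⟨f⟩ => ⟨(FibreQuot.incl M i j).map f⟩
  rw [PScalar.card_eq_sum _ o' ho', Fintype.sum_sigma]
  refine Finset.sum_congr rfl fun x _ => ?_
  rw [Fintype.sum_prod_type, signedHom, signedHom, Finset.sum_mul, Finset.sum_mul, Finset.sum_div,
    Finset.sum_div]
  refine Finset.sum_congr rfl fun a _ => ?_
  rw [Finset.mul_sum, Finset.sum_div, Finset.sum_div]
  refine Finset.sum_congr rfl fun b _ => ?_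
  have hs : (M.fibreQuot i j hj).sign (o' ⟨x, a, b⟩) = parity a * M.sign (o x) * parity b :=
    M.sign_fibrePoint _ a b
  rw [hs, map_mul, map_mul, div_div]
  congr 1
  rw [← Nat.cast_mul]
  congr 1
  -- For each group element `g`, unique lifting applies to the point with `b` replaced by `b ≫
  -- g.hom`.
  have key : ∀ y, ∑ c : (i ⟶ M.left.obj (o y)) × (M.right.obj (o y) ⟶ j),
      Fintype.card (o' ⟨x, a, b⟩ ⟶ o' ⟨y, c⟩) =
      Fintype.card (o x ⟶ o y) * Fintype.card (j ⟶ j) := by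
    intro y
    have h : ∀ c, Fintype.card (o' ⟨x, a, b⟩ ⟶ o' ⟨y, c⟩) = ∑ g : j ≅ j, Nat.card
        {f : o x ⟶ o y // a ≫ M.left.map f = c.1 ∧ M.right.map f ≫ c.2 = b ≫ g.hom} := fun c => by
      rw [← Nat.card_sigma, ← Nat.card_eq_fintype_card]
      exact Nat.card_congr (M.fibreQuotHomEquiv a b c.1 c.2)
    rw [Finset.sum_congr rfl fun c _ => h c, Finset.sum_comm,
      Finset.sum_congr rfl fun g _ =>
        Nat.card_sigma.symm.trans (M.card_sigma_lifts (n := o y) a (b ≫ g.hom)),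
      Finset.sum_const, smul_eq_mul, mul_comm, Finset.card_univ, ← natCard_aut,
      ← Nat.card_eq_fintype_card (α := j ≅ j)]
    rfl
  rw [outDegree, Fintype.sum_sigma, Finset.sum_congr rfl fun y _ => key y, ← Finset.sum_mul,
    outDegree]

theorem exists_hom_out (C : Type*) [Category C] (y : C) :
    ∃ c : Pi0 C, Nonempty (y ⟶ c.out) := by
  obtain ⟨e⟩ := Pi0.exact (Pi0.mk_out (Pi0.mk y))
  exact ⟨_, ⟨e.inv⟩⟩

theorem card_fibre_of_not_orientable_left (M : PSpan I J) {i : I} (hi : ¬ IsOrientable I i)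
    (j : J) : PScalar.card (M.fibre i j) = 0 := by
  rw [M.card_fibre i j Pi0.out (exists_hom_out _)]
  simp [signedHom_of_not_orientable_left hi]

theorem card_fibre_of_not_orientable_right (M : PSpan I J) (i : I) {j : J}
    (hj : ¬ IsOrientable J j) : PScalar.card (M.fibre i j) = 0 := by
  rw [M.card_fibre i j Pi0.out (exists_hom_out _)]
  simp [signedHom_of_not_orientable_right hj]

/-! ## Functoriality of the cardinality matrix -/

/-- Evaluate the second cardinality on the images of representatives of the first apex. Full
faithfulness preserves the out-degrees, and the parities of `σ` and `τ` produced by moving the end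
points are absorbed by the compatibility with the signs. -/
theorem card_fibreQuot_congr {M N : PSpan I J} (e : Equivalence M N) (i : I) (j : J)
    (hj : IsOrientable J j) :
    PScalar.card (M.fibreQuot i j hj) = PScalar.card (N.fibreQuot i j hj) := by
  have := e.isEquivalence
  rw [M.card_fibreQuot i j hj Pi0.out (exists_hom_out _),
    N.card_fibreQuot i j hj (fun c : Pi0 M.apex => e.u.obj c.out)]
  · refine Finset.sum_congr rfl fun c _ => ?_
    have h1 : signedHom i (N.left.obj (e.u.obj c.out)) = _ :=
      signedHom_congr_right (e.σ.hom.app c.out) i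
    have h2 : _ = _ * signedHom (N.right.obj (e.u.obj c.out)) j :=
      signedHom_congr_left (e.τ.hom.app c.out) j
    have h3 := congrArg signVal (e.compat c.out)
    rw [map_mul, map_mul] at h3
    have h4 : outDegree (fun c : Pi0 M.apex => e.u.obj c.out) (e.u.obj c.out) =
        outDegree Pi0.out c.out :=
      Finset.sum_congr rfl fun d _ =>
        (Fintype.card_congr (Functor.FullyFaithful.ofFullyFaithful e.u).homEquiv).symm
    rw [h4]
    congr 2
    rw [h1, h2]
    linear_combination -(signedHom i (M.left.obj c.out) *
      signedHom (N.right.obj (e.u.obj c.out)) j) * h3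
  · intro y
    obtain ⟨c, ⟨f⟩⟩ := exists_hom_out M.apex (e.u.objPreimage y)
    exact ⟨c, ⟨(e.u.objObjPreimageIso y).inv ≫ e.u.map f⟩⟩

theorem cardMatrix_congr (bI : BasisChoice I) (bJ : BasisChoice J) {M N : PSpan I J}
    (e : Equivalence M N) : M.cardMatrix bI bJ = N.cardMatrix bI bJ := by
  ext i j
  exact card_fibreQuot_congr e _ _ _

open Classical in
theorem cardMatrix_id (b : BasisChoice I) (i j : Pi0 I.OrientableLocus) :
    (PSpan.id I).cardMatrix b b i j = if i = j then 1 else 0 := by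
  have h := card_fibreQuot (PSpan.id I) (b.pt i).obj (b.pt j).obj (b.pt j).property Pi0.out
    (exists_hom_out _)
  refine h.trans ?_
  simp only [sign_id, map_one, mul_one]
  -- The apex is `I` itself, so the sum over its points composes the two signed counts into a single
  -- one from `i` to `j`.
  rw [← Finset.sum_div]
  refine (congrArg (· / _) (sum_signedHom_mul Pi0.out (b.pt i).obj (b.pt j).obj
    (exists_hom_out _ _))).trans ?_
  by_cases hij : i = j
  · subst hij
    rw [signedHom_self (b.pt i).property, if_pos rfl]
    have : Nonempty ((b.pt i).obj ⟶ (b.pt i).obj) := ⟨𝟙 _⟩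
    exact div_self (by exact_mod_cast Fintype.card_ne_zero)
  · rw [if_neg hij, signedHom_of_isEmpty, zero_div]
    refine ⟨fun f => hij ?_⟩
    rw [← b.mk_pt i, ← b.mk_pt j]
    exact Pi0.sound (ObjectProperty.isoMk _ (asIso f))

/-- A point of a homotopy pullback has as many arrows to the family of points induced from two
families as its two projections together. -/
theorem outDegree_comma {A B T : Type*} [Category A] [Category B] [Category T] [IsGroupoid A]
    [IsGroupoid B] [IsGroupoid T] [HFinite A] [HFinite B] [HFinite T] (L : A ⥤ T) (R : B ⥤ T)
    {κ : Type*} [Fintype κ] (o : ι → A) (o' : κ → B) (X : Comma L R) :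
    outDegree (fun x : (Σ x : ι × κ, (L.obj (o x.1) ⟶ R.obj (o' x.2))) =>
      (⟨o x.1.1, o' x.1.2, x.2⟩ : Comma L R)) X = outDegree o X.left * outDegree o' X.right := by
  rw [outDegree, Fintype.sum_sigma, outDegree, outDegree, Finset.sum_mul_sum,
    ← Fintype.sum_prod_type']
  refine Finset.sum_congr rfl fun x _ => ?_
  rw [← Fintype.card_prod, ← Fintype.card_sigma]
  exact Fintype.card_congr
    { toFun := fun f => (f.2.left, f.2.right)
      -- The two projections of an arrow out of `X` determine the structure arrow of its target.
      invFun := fun f => ⟨inv (L.map f.1) ≫ X.hom ≫ R.map f.2, f.1, f.2, by simp⟩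
      left_inv := by
        rintro ⟨h, ⟨f, g, w⟩⟩
        dsimp only at f g w
        obtain rfl : inv (L.map f) ≫ X.hom ≫ R.map g = h := by
          rw [IsIso.inv_comp_eq]; exact w.symm
        rfl
      right_inv := fun f => rfl }

theorem exists_hom_comma {A B T : Type*} [Category A] [Category B] [Category T] [IsGroupoid T]
    (L : A ⥤ T) (R : B ⥤ T) [IsGroupoid A]
    {ι κ : Type*} {o : ι → A} {o' : κ → B} (ho : ∀ y, ∃ x, Nonempty (y ⟶ o x))
    (ho' : ∀ y, ∃ x, Nonempty (y ⟶ o' x)) (X : Comma L R) :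
    ∃ x : (Σ x : ι × κ, (L.obj (o x.1) ⟶ R.obj (o' x.2))),
      Nonempty (X ⟶ (⟨o x.1.1, o' x.1.2, x.2⟩ : Comma L R)) := by
  obtain ⟨x, ⟨f⟩⟩ := ho X.left
  obtain ⟨y, ⟨g⟩⟩ := ho' X.right
  exact ⟨⟨(x, y), inv (L.map f) ≫ X.hom ≫ R.map g⟩, ⟨⟨f, g, by simp⟩⟩⟩

/-- Both sides become double sums over points of the two apices: the left with the signed count
between `M.right.obj (o m)` and `N.left.obj (o' n)`, the right with its expansion through the basis
points of `J`. -/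
theorem card_fibreQuot_comp (M : PSpan I J) (N : PSpan J K) (i : I) (k : K)
    (hk : IsOrientable K k) (b : BasisChoice J) :
    PScalar.card ((M.comp N).fibreQuot i k hk) =
      ∑ j, PScalar.card (M.fibreQuot i (b.pt j).obj (b.pt j).property) *
        PScalar.card (N.fibreQuot (b.pt j).obj k hk) := by
  let o : Pi0 M.apex → M.apex := Pi0.out
  let o' : Pi0 N.apex → N.apex := Pi0.out
  have h := card_fibreQuot (M.comp N) i k hk _
    (exists_hom_comma M.right N.left (exists_hom_out M.apex) (exists_hom_out N.apex))
  refine h.trans ?_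
  calc _ = ∑ m, ∑ n, signedHom i (M.left.obj (o m)) * signVal (M.sign (o m)) *
          signedHom (M.right.obj (o m)) (N.left.obj (o' n)) * signVal (N.sign (o' n)) *
          signedHom (N.right.obj (o' n)) k / outDegree o (o m) / outDegree o' (o' n) /
          Fintype.card (k ⟶ k) := by
        rw [Fintype.sum_sigma, Fintype.sum_prod_type]
        refine Finset.sum_congr rfl fun m _ => Finset.sum_congr rfl fun n _ => ?_
        -- Expanding only the middle count matches it with the sum over the structure arrows of the
        -- homotopy pullback.
        rw [signedHom.eq_def (M.right.obj (o m))]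
        simp only [Finset.mul_sum, Finset.sum_mul, Finset.sum_div]
        refine Finset.sum_congr rfl fun a _ => ?_
        rw [outDegree_comma, sign_comp, map_mul, map_mul]
        push_cast
        change signedHom i (M.left.obj (o m)) *
          (signVal (M.sign (o m)) * signVal (parity a) * signVal (N.sign (o' n))) *
          signedHom (N.right.obj (o' n)) k / _ / _ = _
        ring
    _ = _ := by
        rw [Finset.sum_congr rfl fun j _ => congrArg₂ (· * ·)
          (M.card_fibreQuot i (b.pt j).obj (b.pt j).property o (exists_hom_out _))
          (N.card_fibreQuot (b.pt j).obj k hk o' (exists_hom_out _))]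
        simp only [Finset.sum_mul_sum]
        refine Eq.trans ?_ Finset.sum_comm
        refine Finset.sum_congr rfl fun m _ => ?_
        refine Eq.trans ?_ Finset.sum_comm
        refine Finset.sum_congr rfl fun n _ => ?_
        -- This is where the non-orientable points of `J` drop out.
        rw [← sum_basisChoice_signedHom_mul b (M.right.obj (o m)) (N.left.obj (o' n))]
        simp only [Finset.mul_sum, Finset.sum_mul, Finset.sum_div]
        refine Finset.sum_congr rfl fun j _ => ?_
        ring

theorem cardMatrix_comp (bI : BasisChoice I) (bJ : BasisChoice J) (bK : BasisChoice K)
    (M : PSpan I J) (N : PSpan J K) :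
    (M.comp N).cardMatrix bI bK = M.cardMatrix bI bJ * N.cardMatrix bJ bK := by
  ext i k
  exact card_fibreQuot_comp M N _ _ _ bJ

/-! ### From matrices to linear maps -/

theorem cardMap_single (bI : BasisChoice I) (bJ : BasisChoice J) (M : PSpan I J)
    (i : Pi0 I.OrientableLocus) :
    M.cardMap bI bJ (Finsupp.single i 1) = ∑ j, Finsupp.single j (M.cardMatrix bI bJ i j) := by
  simp [cardMap]

theorem cardMap_congr (bI : BasisChoice I) (bJ : BasisChoice J) {M N : PSpan I J}
    (e : Equivalence M N) : M.cardMap bI bJ = N.cardMap bI bJ := by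
  rw [cardMap, cardMap, cardMatrix_congr bI bJ e]

theorem cardMap_id (b : BasisChoice I) : (PSpan.id I).cardMap b b = LinearMap.id := by
  classical
  refine Finsupp.lhom_ext' fun i => LinearMap.ext_ring ?_
  change (PSpan.id I).cardMap b b (Finsupp.single i 1) = Finsupp.single i 1
  rw [cardMap_single, Finset.sum_eq_single i]
  · rw [cardMatrix_id, if_pos rfl]
  · intro j _ hj
    rw [cardMatrix_id, if_neg hj.symm, Finsupp.single_zero]
  · simp

/-- Rows of the matrix index the source, so the product of matrices in diagrammatic order
corresponds to composing the maps in the opposite written order. -/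
theorem cardMap_comp (bI : BasisChoice I) (bJ : BasisChoice J) (bK : BasisChoice K)
    (M : PSpan I J) (N : PSpan J K) :
    (M.comp N).cardMap bI bK = N.cardMap bJ bK ∘ₗ M.cardMap bI bJ := by
  refine Finsupp.lhom_ext' fun i => LinearMap.ext_ring ?_
  change (M.comp N).cardMap bI bK (Finsupp.single i 1) =
    N.cardMap bJ bK (M.cardMap bI bJ (Finsupp.single i 1))
  rw [cardMap_single, cardMap_single, cardMatrix_comp bI bJ bK, map_sum]
  have h : ∀ j, N.cardMap bJ bK (Finsupp.single j (M.cardMatrix bI bJ i j)) =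
      ∑ k, Finsupp.single k (M.cardMatrix bI bJ i j * N.cardMatrix bJ bK j k) := by
    intro j
    rw [← mul_one (M.cardMatrix bI bJ i j), ← smul_eq_mul, ← Finsupp.smul_single, map_smul,
      cardMap_single, Finset.smul_sum]
    simp
  rw [Finset.sum_congr rfl fun j _ => h j, Finset.sum_comm]
  refine Finset.sum_congr rfl fun k _ => ?_
  exact (congrArg _ (Matrix.mul_apply ..)).trans (map_sum (Finsupp.singleAddHom k) _ _)

end PSpan

/-- The cardinality functor. -/
noncomputable def cardFunctor (b : ∀ T : ParityGroupoid.{u}, BasisChoice T) :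
    LinPM.{u} ⥤ FGModuleCat.{u} ℚ where
  obj T := FGModuleCat.of ℚ (cardSpace T.base)
  map {I J} := Quotient.lift
    (fun M : PSpan I.base J.base => FGModuleCat.ofHom (M.cardMap (b I.base) (b J.base)))
    fun _ _ ⟨e⟩ => congrArg FGModuleCat.ofHom (PSpan.cardMap_congr _ _ e)
  map_id I := congrArg FGModuleCat.ofHom (PSpan.cardMap_id (b I.base))
  map_comp := by
    rintro I J K ⟨M⟩ ⟨N⟩
    exact congrArg FGModuleCat.ofHom
      (PSpan.cardMap_comp (b I.base) (b J.base) (b K.base) M N)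

theorem mainTheorem3 (b : ∀ T : ParityGroupoid.{u}, BasisChoice T) :
    (∃ (F : LinPM.{u} ⥤ FGModuleCat.{u} ℚ)
        (hobj : ∀ T : LinPM.{u}, F.obj T = FGModuleCat.of ℚ (cardSpace T.base)),
        ∀ (I J : LinPM.{u}) (M : PSpan I.base J.base),
          F.map (PSpan.toHom M : I ⟶ J) =
            eqToHom (hobj I) ≫ FGModuleCat.ofHom (M.cardMap (b I.base) (b J.base)) ≫
              eqToHom (hobj J).symm) ∧
    (∀ (I J K : ParityGroupoid.{u}) (M : PSpan I J) (N : PSpan J K),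
      (∀ (i : Pi0 I.OrientableLocus) (k : Pi0 K.OrientableLocus),
        (M.comp N).cardMatrix (b I) (b K) i k =
          ∑ j : Pi0 J.OrientableLocus,
            M.cardMatrix (b I) (b J) i j * N.cardMatrix (b J) (b K) j k) ∧
      (∀ j : J, ¬ ParityGroupoid.IsOrientable J j →
        (∀ i : I, PScalar.card (M.fibre i j) = 0) ∧
          ∀ k : K, PScalar.card (N.fibre j k) = 0)) := by
  refine ⟨⟨cardFunctor b, fun _ => rfl, fun I J M => ?_⟩, fun I J K M N => ⟨fun i k => ?_,
    fun j hj => ⟨fun i => M.card_fibre_of_not_orientable_right i hj,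
      fun k => N.card_fibre_of_not_orientable_left hj k⟩⟩⟩
  -- The object equalities hold by `rfl`, so both transports are identities.
  · exact ((Category.id_comp _).trans (Category.comp_id _)).symm
  · rw [PSpan.cardMatrix_comp (b I) (b J) (b K) M N, Matrix.mul_apply]
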